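/- Let $G$ be a group with a finite set of generators. For a finite set $T$ of generators of $G$ and $n\in\mathbb N$ let $D_{n,T}$ be the set of those elements of $G$ that are products of at most $n$ factors from $T\cup T^{-1}$ (the disk of radius $n$ around $1_G$ in the Cayley graph). Assume that $G$ is of subexponential growth: for some (equivalently, every) finite set $T$ of generators and for every real $\lambda>1$ there are $C>0$ and $n_0$ such that $|D_{n,T}|\le C\lambda^n$ for all $n\ge n_0$. Let $S$ be any finite set of generators of $G$, let $Q$ be a finite set with at least two elements, and let $\mathcal A=\langle Q,\mathcal N,f\rangle$ be a cellular automaton over $G$: $\mathcal N\subseteq G$ is finite and nonempty, $f:Q^{\mathcal N}\to Q$, and the global evolution function $F:Q^G\to Q^G$ is $F(c)(g)=f\big((c(gz))_{z\in\mathcal N}\big)$. For $c_1,c_2\in Q^G$ put $$d_{B,S}(c_1,c_2)=\limsup_{n\to\infty}\frac{|\{g\in D_{n,S}: c_1(g)\ne c_2(g)\}|}{|D_{n,S}|}.$$ Call $\mathcal A$ $(B,S)$-surjective if for every $c\in Q^G$ there is $c'\in Q^G$ with $d_{B,S}(c,F(c'))=0$, and $(B,S)$-injective if $d_{B,S}(c_1,c_2)>0$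 implies $d_{B,S}(F(c_1),F(c_2))>0$ for all $c_1,c_2\in Q^G$. Call $\mathcal A$ preinjective if there are no finite $E\subseteq G$ and distinct $p_1,p_2\in Q^E$ such that $F(c_1)=F(c_2)$ whenever $c_1|_E=p_1$, $c_2|_E=p_2$ and $c_1|_{G\setminus E}=c_2|_{G\setminus E}$. Then: 1. If $\mathcal A$ is $(B,S)$-surjective, then $F$ is surjective. 2. If $\mathcal A$ is $(B,S)$-injective, then $\mathcal A$ is preinjective. 3. If $\mathcal A$ is $(B,S)$-injective, then $\mathcal A$ is $(B,S)$-surjective. -/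

import Mathlib

open Filter

namespace Besicovitch

/-! ### Generating sets, disks, growth -/

section Growth

variable {G : Type*} [Group G]

/-- `S` is a set of generators of `G`: the graph on `G` in which `x` is joined to `x z` for all
`x : G` and `z ∈ S ∪ S⁻¹` is connected. -/
def Generates (S : Set G) : Prop := (SimpleGraph.mulCayley S).Connected

/-- The disk of center `1` and radius `n`: the elements at distance at most `n` from the identity
in the Cayley graph of `G` with respect to `S`. -/
def disk (S : Set G) (n : ℕ) : Set G :=
  {g | (SimpleGraph.mulCayley S).edist 1 g ≤ (n : ℕ∞)}

/-- The disks of a finite set are finite, so that their cardinality `Set.ncard` is the true one. -/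
theorem disk_finite {S : Set G} (hS : S.Finite) (n : ℕ) : (disk S n).Finite := by
  classical
  have key : ∀ n : ℕ, {g : G | ∃ p : (SimpleGraph.mulCayley S).Walk g 1, p.length ≤ n}.Finite := by
    intro n
    induction n with
    | zero =>
      refine (Set.finite_singleton (1 : G)).subset ?_
      rintro g ⟨p, hp⟩
      exact SimpleGraph.Walk.eq_of_length_eq_zero (Nat.le_zero.mp hp)
    | succ k ih =>
      refine (((Set.finite_singleton (1 : G)).union
        (Set.Finite.image2 (fun a s => a * s) ih hS)).union
        (Set.Finite.image2 (fun a s => a * s⁻¹) ih hS)).subset ?_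
      rintro g ⟨p, hp⟩
      cases p with
      | nil => exact Or.inl (Or.inl rfl)
      | @cons _ v _ h q =>
        rw [SimpleGraph.Walk.length_cons] at hp
        have hv : v ∈ {g : G | ∃ p : (SimpleGraph.mulCayley S).Walk g 1, p.length ≤ k} :=
          ⟨q, by omega⟩
        rw [SimpleGraph.mulCayley_adj'] at h
        obtain ⟨-, s, hs, h | h⟩ := h
        · exact Or.inr ⟨v, hv, s, hs, by simp [← h]⟩
        · exact Or.inl (Or.inr ⟨v, hv, s, hs, h.symm⟩)
  refine (key n).subset ?_
  intro g hg
  have hg' : (SimpleGraph.mulCayley S).edist 1 g ≤ (n : ℕ∞) := hg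
  obtain ⟨p, hp⟩ := SimpleGraph.exists_walk_of_edist_ne_top
    (ne_top_of_le_ne_top (ENat.natCast_ne_top n) hg')
  refine ⟨p.reverse, ?_⟩
  rw [SimpleGraph.Walk.length_reverse]
  rw [← hp] at hg'
  exact_mod_cast hg'

/-- The growth function of `G` with respect to `S`. -/
noncomputable def growth (S : Set G) (n : ℕ) : ℕ := (disk S n).ncard

variable (G) in
/-- `G` is (finitely generated and) of subexponential growth: for a finite set of generators,
the growth function is bounded, for every `a > 1`, by a constant times `a ^ n` for large `n`.
(This does not depend on the finite set of generators.) -/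
def SubexponentialGrowth : Prop :=
  ∃ S : Set G, S.Finite ∧ Generates S ∧
    ∀ a : ℝ, 1 < a → ∃ C : ℝ, 0 < C ∧ ∀ᶠ n : ℕ in atTop, (growth S n : ℝ) ≤ C * a ^ n

end Growth

/-! ### The Besicovitch distance -/

section Distance

variable {G Q : Type*}

/-- The Hamming distance of two configurations with respect to a finite set `U`. -/
noncomputable def hamming (U : Set G) (c₁ c₂ : G → Q) : ℕ :=
  {x ∈ U | c₁ x ≠ c₂ x}.ncard

/-- The Besicovitch distance with respect to a sequence of finite sets `X n`. The quotients lie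
in `[0, 1]`, so that the upper limit is a genuine one. -/
noncomputable def besicovitchDist (X : ℕ → Set G) (c₁ c₂ : G → Q) : ℝ :=
  limsup (fun n : ℕ => (hamming (X n) c₁ c₂ : ℝ) / ((X n).ncard : ℝ)) atTop

/-- Besicovitch surjectivity of a transformation of the configuration space. -/
def BSurjective (X : ℕ → Set G) (F : (G → Q) → (G → Q)) : Prop :=
  ∀ c : G → Q, ∃ c' : G → Q, besicovitchDist X c (F c') = 0

/-- Besicovitch injectivity of a transformation of the configuration space. -/
def BInjective (X : ℕ → Set G) (F : (G → Q) → (G → Q)) : Prop :=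
  ∀ c₁ c₂ : G → Q, 0 < besicovitchDist X c₁ c₂ → 0 < besicovitchDist X (F c₁) (F c₂)

end Distance

/-! ### Cellular automata -/

/-- A cellular automaton over `G` with set of states `Q` (finite with at least two elements
wherever it is used). -/
structure CellularAutomaton (G Q : Type*) where
  /-- the neighborhood index -/
  neighborhood : Finset G
  neighborhood_nonempty : neighborhood.Nonempty
  /-- the local evolution function -/
  localRule : (neighborhood → Q) → Q

namespace CellularAutomaton

variable {G Q : Type*} [Group G]

/-- The global evolution function. -/
def globalMap (A : CellularAutomaton G Q) (c : G → Q) : G → Q :=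
  fun g => A.localRule fun z => c (g * z)

/-- Two patterns with the same support `E` are mutually erasable. -/
def MutuallyErasable (A : CellularAutomaton G Q) {E : Finset G} (p₁ p₂ : E → Q) : Prop :=
  ∀ c₁ c₂ : G → Q, (∀ x : E, c₁ x = p₁ x) → (∀ x : E, c₂ x = p₂ x) →
    (∀ x, x ∉ E → c₁ x = c₂ x) → A.globalMap c₁ = A.globalMap c₂

/-- Preinjectivity: there are no two distinct mutually erasable patterns. -/
def Preinjective (A : CellularAutomaton G Q) : Prop :=
  ¬ ∃ (E : Finset G) (p₁ p₂ : E → Q), p₁ ≠ p₂ ∧ A.MutuallyErasable p₁ p₂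

end CellularAutomaton

end Besicovitch

/-!
Let `E` be a finite nonempty subset of `G`. A maximal family `N` of points with pairwise disjoint
translates `g E`, `g ∈ N`, is syndetic, so two configurations that differ somewhere on each of
these translates are at positive Besicovitch distance (`besicovitchDist_disk_pos_of_packing`).

If `F` is not surjective, compactness provides an orphan `p` on some `E` (`exists_orphan`); a
configuration with copies of `p` on the translates `g E` is at positive distance from the whole
image of `F`, so `F` is not Besicovitch surjective. If there are two distinct mutually erasable
patterns on `E`, their copies on the translates `g E` yield two configurations at positive
distance with the same image (`MutuallyErasable.globalMap_eq_of_packing`), so `F` is not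
Besicovitch injective.

The third claim goes through surjectivity of `F`: Besicovitch injectivity implies preinjectivity,
and preinjectivity implies surjectivity by the counting argument of Myhill's theorem
(`CellularAutomaton.Preinjective.surjective`). This is the only place where the growth matters:
subexponential growth makes disks of suitable radii a Følner sequence (`exists_growth_add_lt`).
-/

namespace Besicovitch

/-! ### Disks in the Cayley graph -/

section Disks

variable {G : Type*} [Group G] {S : Set G}

theorem edist_mulCayley_mul_left (g x y : G) :
    (SimpleGraph.mulCayley S).edist (g * x) (g * y) = (SimpleGraph.mulCayley S).edist x y := by
  have key : ∀ g x y : G, (SimpleGraph.mulCayley S).edist (g * x) (g * y) ≤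
      (SimpleGraph.mulCayley S).edist x y := by
    intro g x y
    by_cases h : (SimpleGraph.mulCayley S).edist x y = ⊤
    · rw [h]; exact le_top
    obtain ⟨p, hp⟩ := SimpleGraph.exists_walk_of_edist_ne_top h
    let φ : SimpleGraph.mulCayley S →g SimpleGraph.mulCayley S :=
      ⟨fun z => g * z, fun h => SimpleGraph.mulCayley_adj_mul_iff_right.2 h⟩
    rw [← hp, ← SimpleGraph.Walk.length_map φ p]
    exact SimpleGraph.edist_le (p.map φ)
  refine le_antisymm (key g x y) ?_
  simpa using key g⁻¹ (g * x) (g * y)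

theorem one_mem_disk (n : ℕ) : (1 : G) ∈ disk S n := by
  simp [disk]

theorem mul_mem_disk {m n : ℕ} {x y : G} (hx : x ∈ disk S m) (hy : y ∈ disk S n) :
    x * y ∈ disk S (m + n) := by
  have hx' : (SimpleGraph.mulCayley S).edist 1 x ≤ (m : ℕ∞) := hx
  have hy' : (SimpleGraph.mulCayley S).edist 1 y ≤ (n : ℕ∞) := hy
  have h := edist_mulCayley_mul_left (S := S) x 1 y
  rw [mul_one] at h
  change (SimpleGraph.mulCayley S).edist 1 (x * y) ≤ ((m + n : ℕ) : ℕ∞)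
  push_cast
  exact SimpleGraph.edist_triangle.trans (add_le_add hx' (h.trans_le hy'))

theorem exists_mul_eq_of_mem_disk_add {m n : ℕ} {x : G} (hx : x ∈ disk S (m + n)) :
    ∃ y ∈ disk S m, ∃ z ∈ disk S n, y * z = x := by
  have hx' : (SimpleGraph.mulCayley S).edist 1 x ≤ ((m + n : ℕ) : ℕ∞) := hx
  obtain ⟨p, hp⟩ := SimpleGraph.exists_walk_of_edist_ne_top
    (ne_top_of_le_ne_top (ENat.natCast_ne_top _) hx')
  have hlen : p.length ≤ m + n := by rw [← hp] at hx'; exact_mod_cast hx'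
  refine ⟨p.getVert m, ?_, (p.getVert m)⁻¹ * x, ?_, by simp⟩
  · refine (SimpleGraph.edist_le (p.take m)).trans ?_
    rw [SimpleGraph.Walk.take_length]
    exact_mod_cast min_le_left _ _
  · change (SimpleGraph.mulCayley S).edist 1 _ ≤ (n : ℕ∞)
    have h := edist_mulCayley_mul_left (S := S) (p.getVert m) 1 ((p.getVert m)⁻¹ * x)
    rw [mul_one, mul_inv_cancel_left] at h
    rw [← h]
    refine (SimpleGraph.edist_le (p.drop m)).trans ?_
    rw [SimpleGraph.Walk.drop_length]
    exact_mod_cast (by omega : p.length - m ≤ n)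

theorem disk_mono {m n : ℕ} (h : m ≤ n) : disk S m ⊆ disk S n := fun x hx =>
  le_trans (show (SimpleGraph.mulCayley S).edist 1 x ≤ (m : ℕ∞) from hx) (by exact_mod_cast h)

theorem Generates.exists_mem_disk (hS : Generates S) (x : G) : ∃ n, x ∈ disk S n := by
  obtain ⟨p, hp⟩ := SimpleGraph.Connected.exists_walk_length_eq_edist hS 1 x
  exact ⟨p.length, hp.symm.le⟩

theorem Generates.exists_subset_disk (hS : Generates S) (V : Finset G) :
    ∃ n, (V : Set G) ⊆ disk S n := by
  choose f hf using hS.exists_mem_disk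
  exact ⟨V.sup f, fun x hx => disk_mono (Finset.le_sup hx) (hf x)⟩

theorem growth_pos (hS : S.Finite) (n : ℕ) : 0 < growth S n :=
  (Set.ncard_pos (disk_finite hS n)).2 ⟨1, one_mem_disk n⟩

open scoped Pointwise in
theorem growth_add_le (hS : S.Finite) (m n : ℕ) :
    growth S (m + n) ≤ growth S m * growth S n := by
  have hsub : disk S (m + n) ⊆ disk S m * disk S n := fun x hx =>
    let ⟨y, hy, z, hz, h⟩ := exists_mul_eq_of_mem_disk_add hx
    ⟨y, hy, z, hz, h⟩
  calc growth S (m + n) ≤ (disk S m * disk S n).ncard :=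
        Set.ncard_le_ncard hsub ((disk_finite hS m).mul (disk_finite hS n))
    _ ≤ growth S m * growth S n := Set.natCard_mul_le

/-- If the growth is subexponential, the disks contain a Følner sequence: the disk of radius
`n + k` exceeds that of radius `n` by an arbitrarily small proportion, for a suitable `n`.
Otherwise the growth along the multiples of `k` would be geometric. -/
theorem exists_growth_add_lt (hS : S.Finite)
    (hg : ∀ a : ℝ, 1 < a → ∃ C : ℝ, 0 < C ∧ ∀ᶠ n : ℕ in atTop, (growth S n : ℝ) ≤ C * a ^ n)
    (k : ℕ) {ε : ℝ} (hε : 0 < ε) :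
    ∃ n, (growth S (n + k) : ℝ) ≤ (1 + ε) * growth S n := by
  by_contra! hcon
  have hgeom : ∀ m : ℕ, (1 + ε) ^ m ≤ growth S (k * m) := by
    intro m
    induction m with
    | zero => simpa [Nat.one_le_iff_ne_zero] using (growth_pos hS 0).ne'
    | succ m ih =>
      rw [pow_succ', mul_add, mul_one]
      exact (mul_le_mul_of_nonneg_left ih (by linarith)).trans (hcon _).le
  -- a base `a > 1` whose `k`-th power is still below `1 + ε`
  obtain ⟨a, ha1, hak⟩ : ∃ a : ℝ, 1 < a ∧ a ^ k < 1 + ε := by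
    have hc : ContinuousAt (fun a : ℝ => a ^ k) 1 := (continuous_pow k).continuousAt
    have h1 : ∀ᶠ a : ℝ in nhds 1, a ^ k < 1 + ε :=
      hc.eventually (gt_mem_nhds (by simpa using hε))
    have h2 : ∀ᶠ a : ℝ in nhdsWithin 1 (Set.Ioi 1), a ^ k < 1 + ε ∧ 1 < a :=
      (h1.filter_mono nhdsWithin_le_nhds).and self_mem_nhdsWithin
    obtain ⟨a, h⟩ := h2.exists
    exact ⟨a, h.2, h.1⟩
  have hk : 0 < k := by
    rcases Nat.eq_zero_or_pos k with rfl | h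
    · have := hcon 0
      have := growth_pos hS 0
      have h' : (0 : ℝ) < growth S 0 := by exact_mod_cast this
      simp only [add_zero] at *
      nlinarith
    · exact h
  obtain ⟨C, hC, hev⟩ := hg a ha1
  have hak0 : 0 < a ^ k := by positivity
  have htend : Tendsto (fun m : ℕ => ((1 + ε) / a ^ k) ^ m) atTop atTop :=
    tendsto_pow_atTop_atTop_of_one_lt ((one_lt_div hak0).2 hak)
  have hmul : Tendsto (fun m : ℕ => k * m) atTop atTop := tendsto_id.const_mul_atTop' hk
  obtain ⟨m, hm1, hm2⟩ := ((hmul.eventually hev).and (htend.eventually_gt_atTop C)).exists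
  rw [div_pow, lt_div_iff₀ (by positivity), ← pow_mul] at hm2
  exact absurd ((hgeom m).trans hm1) (not_le.2 hm2)

end Disks

/-! ### Positivity of the Besicovitch distance -/

section Distance

variable {G Q : Type*}

theorem besicovitchDist_self (X : ℕ → Set G) (c : G → Q) : besicovitchDist X c c = 0 := by
  simp [besicovitchDist, hamming]

open scoped Pointwise in
/-- Configurations that differ on a syndetic set are at positive Besicovitch distance. This needs
no assumption on the growth: since `growth S (n + k) ≤ growth S n * growth S k`, enlarging the
disks by a constant radius multiplies their cardinality by a bounded factor only. -/
theorem besicovitchDist_disk_pos [Group G] {S : Set G} (hSfin : S.Finite) (hS : Generates S)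
    {c₁ c₂ : G → Q} (V : Finset G) (hV : ∀ h : G, ∃ v ∈ V, c₁ (h * v) ≠ c₂ (h * v)) :
    0 < besicovitchDist (disk S) c₁ c₂ := by
  obtain ⟨k, hk⟩ := hS.exists_subset_disk V
  have hVne : V.Nonempty := let ⟨v, hv, _⟩ := hV 1; ⟨v, hv⟩
  have hVpos : (0 : ℝ) < V.card := by exact_mod_cast hVne.card_pos
  have hgk : (0 : ℝ) < growth S k := by exact_mod_cast growth_pos hSfin k
  set δ : ℝ := 1 / (V.card * growth S k) with hδ
  have hlow : ∀ n, δ ≤ (hamming (disk S (n + k)) c₁ c₂ : ℝ) / ((disk S (n + k)).ncard : ℝ) := by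
    intro n
    have hfin : {x ∈ disk S (n + k) | c₁ x ≠ c₂ x}.Finite :=
      (disk_finite hSfin (n + k)).subset (Set.sep_subset _ _)
    have hsub : disk S n ⊆ {x ∈ disk S (n + k) | c₁ x ≠ c₂ x} * (V : Set G)⁻¹ := by
      intro h hh
      obtain ⟨v, hv, hne⟩ := hV h
      exact ⟨h * v, ⟨mul_mem_disk hh (hk hv), hne⟩, v⁻¹, by simpa using hv, by simp⟩
    have h1 : growth S n ≤ hamming (disk S (n + k)) c₁ c₂ * V.card := by
      refine (Set.ncard_le_ncard hsub (hfin.mul V.finite_toSet.inv)).trans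
        (Set.natCard_mul_le.trans_eq ?_)
      rw [Set.natCard_inv]
      simp [hamming, Set.ncard]
    have h2 := growth_add_le hSfin n k
    have h3 : growth S (n + k) ≤ hamming (disk S (n + k)) c₁ c₂ * V.card * growth S k :=
      h2.trans (Nat.mul_le_mul_right _ h1)
    have h4 : (growth S (n + k) : ℝ) ≤
        hamming (disk S (n + k)) c₁ c₂ * V.card * growth S k := by exact_mod_cast h3
    have hpos : (0 : ℝ) < growth S (n + k) := by exact_mod_cast growth_pos hSfin (n + k)
    change δ ≤ (hamming (disk S (n + k)) c₁ c₂ : ℝ) / (growth S (n + k) : ℝ)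
    rw [hδ, div_le_div_iff₀ (by positivity) hpos]
    linarith
  have hev : ∀ᶠ n : ℕ in atTop,
      δ ≤ (hamming (disk S n) c₁ c₂ : ℝ) / ((disk S n).ncard : ℝ) := by
    filter_upwards [eventually_ge_atTop k] with n hn
    obtain ⟨m, rfl⟩ := Nat.exists_eq_add_of_le' hn
    exact hlow m
  have hbdd : IsBoundedUnder (· ≤ ·) atTop
      fun n : ℕ => (hamming (disk S n) c₁ c₂ : ℝ) / ((disk S n).ncard : ℝ) := by
    refine isBoundedUnder_of ⟨1, fun n => div_le_one_of_le₀ ?_ (by positivity)⟩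
    exact_mod_cast Set.ncard_le_ncard (Set.sep_subset _ _) (disk_finite hSfin n)
  exact lt_of_lt_of_le (by positivity) (le_limsup_of_frequently_le hev.frequently hbdd)

end Distance

/-! ### Packings by translates of a finite set -/

section Packing

variable {G Q : Type*} [Group G]

/-- The left translates `g E`, for `g ∈ N`, are pairwise disjoint. -/
def IsPacking (N : Set G) (E : Finset G) : Prop :=
  ∀ g ∈ N, ∀ h ∈ N, ∀ x ∈ E, ∀ y ∈ E, g * x = h * y → g = h

/-- A maximal packing: every translate of `E` meets one of the translates of the packing. -/
theorem exists_isPacking {E : Finset G} (hE : E.Nonempty) :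
    ∃ N : Set G, IsPacking N E ∧ ∀ h : G, ∃ g ∈ N, ∃ x ∈ E, ∃ y ∈ E, h * x = g * y := by
  obtain ⟨N, hN⟩ := zorn_subset {N : Set G | IsPacking N E} (by
    intro c hc hchain
    refine ⟨⋃₀ c, ?_, fun s hs => Set.subset_sUnion_of_mem hs⟩
    rintro g ⟨s, hs, hg⟩ h ⟨t, ht, hh⟩
    rcases hchain.total hs ht with hst | hst
    · exact hc ht g (hst hg) h hh
    · exact hc hs g hg h (hst hh))
  refine ⟨N, hN.prop, fun h => ?_⟩
  by_contra! hcon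
  obtain ⟨e, he⟩ := hE
  have hmem : h ∈ N := by
    refine hN.le_of_ge (y := insert h N) ?_ (Set.subset_insert h N) (Set.mem_insert h N)
    rintro g (rfl | hg) g' (rfl | hg') x hx y hy hxy
    · rfl
    · exact absurd hxy (hcon g' hg' x hx y hy)
    · exact absurd hxy.symm (hcon g hg y hy x hx)
    · exact hN.prop g hg g' hg' x hx y hy hxy
  exact hcon h hmem e he e he rfl

/-- A pattern can be copied to all the translates of a packing, over a constant background. -/
theorem IsPacking.exists_config {N : Set G} {E : Finset G} (hN : IsPacking N E) (p : G → Q)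
    (q : Q) : ∃ c : G → Q, (∀ g ∈ N, ∀ x ∈ E, c (g * x) = p x) ∧
      ∀ y, (∀ g ∈ N, ∀ x ∈ E, y ≠ g * x) → c y = q := by
  classical
  refine ⟨fun y => if h : ∃ g ∈ N, ∃ x ∈ E, y = g * x then p (h.choose⁻¹ * y) else q, ?_, ?_⟩
  · intro g hg x hx
    have h : ∃ g' ∈ N, ∃ x' ∈ E, g * x = g' * x' := ⟨g, hg, x, hx, rfl⟩
    obtain ⟨hg', x', hx', h'⟩ := h.choose_spec
    have : g = h.choose := hN g hg _ hg' x hx x' hx' h'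
    simp only [dif_pos h, ← this, inv_mul_cancel_left]
  · intro y hy
    exact dif_neg fun ⟨g, hg, x, hx, h⟩ => hy g hg x hx h

/-- Two configurations that differ somewhere on each translate of a maximal packing are at
positive Besicovitch distance. -/
theorem besicovitchDist_disk_pos_of_packing {S : Set G} (hSfin : S.Finite) (hS : Generates S)
    {N : Set G} {E : Finset G} (hN : ∀ h : G, ∃ g ∈ N, ∃ x ∈ E, ∃ y ∈ E, h * x = g * y)
    {c₁ c₂ : G → Q} (hc : ∀ g ∈ N, ∃ x ∈ E, c₁ (g * x) ≠ c₂ (g * x)) :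
    0 < besicovitchDist (disk S) c₁ c₂ := by
  classical
  refine besicovitchDist_disk_pos hSfin hS
    (Finset.image (fun t : G × G × G => t.1 * t.2.1⁻¹ * t.2.2) (E ×ˢ E ×ˢ E)) fun h => ?_
  obtain ⟨g, hg, x, hx, y, hy, hxy⟩ := hN h
  obtain ⟨z, hz, hne⟩ := hc g hg
  refine ⟨x * y⁻¹ * z, Finset.mem_image.2 ⟨(x, y, z), by simp [hx, hy, hz], rfl⟩, ?_⟩
  have : h * (x * y⁻¹ * z) = g * z := by
    rw [← mul_assoc, ← mul_assoc, hxy, mul_inv_cancel_right]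
  rwa [this]

end Packing

/-! ### Cellular automata: orphans and mutually erasable patterns -/

namespace CellularAutomaton

variable {G Q : Type*} [Group G] (A : CellularAutomaton G Q)

theorem globalMap_comp_mul_left (c : G → Q) (g x : G) :
    A.globalMap (fun y => c (g * y)) x = A.globalMap c (g * x) := by
  simp [globalMap, mul_assoc]

theorem globalMap_congr {c₁ c₂ : G → Q} {x : G}
    (h : ∀ z ∈ A.neighborhood, c₁ (x * z) = c₂ (x * z)) :
    A.globalMap c₁ x = A.globalMap c₂ x :=
  congrArg A.localRule (funext fun z => h z z.2)

/-- A cellular automaton that is not surjective has an orphan: a finite pattern that occurs in no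
configuration of the image, at any place. This is compactness of the configuration space. -/
theorem exists_orphan [Finite Q] (h : ¬ Function.Surjective A.globalMap) :
    ∃ (E : Finset G) (p : G → Q), ∀ (c : G → Q) (g : G), ∃ x ∈ E, A.globalMap c (g * x) ≠ p x := by
  let _ : TopologicalSpace Q := ⊥
  have _ : DiscreteTopology Q := ⟨rfl⟩
  have hcont : Continuous A.globalMap := by
    refine continuous_pi fun g => ?_
    have h1 : Continuous A.localRule := continuous_of_discreteTopology
    exact h1.comp (continuous_pi fun z => continuous_apply _)
  have hclosed : IsClosed (Set.range A.globalMap) := (isCompact_range hcont).isClosed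
  obtain ⟨p, hp⟩ := not_forall.1 h
  obtain ⟨E, u, hu, hsub⟩ := isOpen_pi_iff.1 hclosed.isOpen_compl p hp
  refine ⟨E, p, fun c g => ?_⟩
  by_contra! hcon
  refine hsub (a := A.globalMap fun y => c (g * y)) (fun x hx => ?_) ⟨_, rfl⟩
  rw [A.globalMap_comp_mul_left, hcon x hx]
  exact (hu x hx).2

variable {A}

/-- A preinjective cellular automaton separates configurations that differ on a finite set. -/
theorem Preinjective.eq_of_globalMap_eq (hA : A.Preinjective) {T : Finset G} {c₁ c₂ : G → Q}
    (hT : ∀ x, x ∉ T → c₁ x = c₂ x) (h : A.globalMap c₁ = A.globalMap c₂) : c₁ = c₂ := by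
  classical
  by_contra hne
  obtain ⟨t, ht⟩ := Function.ne_iff.1 hne
  -- `E` contains the neighbourhood of every point whose neighbourhood meets `T`
  let E : Finset G := T ∪ Finset.image (fun s : G × G × G => s.1 * s.2.1⁻¹ * s.2.2)
    (T ×ˢ A.neighborhood ×ˢ A.neighborhood)
  refine hA ⟨E, fun x => c₁ x, fun x => c₂ x, fun heq => ?_, ?_⟩
  · have htT : t ∈ T := by
      by_contra h'
      exact ht (hT t h')
    exact ht (congrFun heq ⟨t, Finset.mem_union_left _ htT⟩)
  · intro d₁ d₂ h₁ h₂ hd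
    funext x
    by_cases hx : ∃ z ∈ A.neighborhood, x * z ∈ T
    · obtain ⟨z, hz, hxz⟩ := hx
      have hmem : ∀ w ∈ A.neighborhood, x * w ∈ E := fun w hw =>
        Finset.mem_union_right _ (Finset.mem_image.2
          ⟨(x * z, z, w), by simp [hxz, hz, hw], by simp⟩)
      have e₁ : A.globalMap d₁ x = A.globalMap c₁ x :=
        A.globalMap_congr fun w hw => h₁ ⟨_, hmem w hw⟩
      have e₂ : A.globalMap d₂ x = A.globalMap c₂ x :=
        A.globalMap_congr fun w hw => h₂ ⟨_, hmem w hw⟩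
      rw [e₁, e₂, h]
    · push Not at hx
      refine A.globalMap_congr fun z hz => ?_
      by_cases hE : x * z ∈ E
      · rw [h₁ ⟨_, hE⟩, h₂ ⟨_, hE⟩]
        exact hT _ (hx z hz)
      · exact hd _ hE

theorem MutuallyErasable.translate {E : Finset G} {p₁ p₂ : E → Q}
    (h : A.MutuallyErasable p₁ p₂) (g : G) {c₁ c₂ : G → Q}
    (h₁ : ∀ x : E, c₁ (g * x) = p₁ x) (h₂ : ∀ x : E, c₂ (g * x) = p₂ x)
    (hc : ∀ y, (∀ x ∈ E, y ≠ g * x) → c₁ y = c₂ y) : A.globalMap c₁ = A.globalMap c₂ := by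
  have key := h (fun y => c₁ (g * y)) (fun y => c₂ (g * y)) h₁ h₂ fun y hy =>
    hc _ fun x hx hxy => hy (mul_left_cancel hxy ▸ hx)
  funext y
  have := congrFun key (g⁻¹ * y)
  simpa only [globalMap_comp_mul_left, mul_inv_cancel_left] using this

/-- Replacing infinitely many disjoint copies of a pattern by copies of a mutually erasable one
does not change the image: each point of the image depends on finitely many copies only, and
these can be replaced one after the other. -/
theorem MutuallyErasable.globalMap_eq_of_packing {E : Finset G} {p₁ p₂ : E → Q}
    (h : A.MutuallyErasable p₁ p₂) {N : Set G} (hN : IsPacking N E) {c₁ c₂ : G → Q}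
    (h₁ : ∀ g ∈ N, ∀ x : E, c₁ (g * x) = p₁ x) (h₂ : ∀ g ∈ N, ∀ x : E, c₂ (g * x) = p₂ x)
    (hc : ∀ y, (∀ g ∈ N, ∀ x ∈ E, y ≠ g * x) → c₁ y = c₂ y) :
    A.globalMap c₁ = A.globalMap c₂ := by
  classical
  -- the configuration with the copies at `M` taken from `c₁` and everything else from `c₂`
  let d : Finset G → G → Q := fun M y => if ∃ g ∈ M, ∃ x ∈ E, y = g * x then c₁ y else c₂ y
  have hd : ∀ M : Finset G, (M : Set G) ⊆ N → A.globalMap (d M) = A.globalMap c₂ := by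
    intro M
    induction M using Finset.induction_on with
    | empty => intro _; simp [d]
    | insert g M hgM ih =>
      intro hM
      rw [Finset.coe_insert, Set.insert_subset_iff] at hM
      rw [← ih hM.2]
      refine h.translate g (fun x => ?_) (fun x => ?_) fun y hy => ?_
      · rw [← h₁ g hM.1 x]
        exact if_pos ⟨g, Finset.mem_insert_self g M, x, x.2, rfl⟩
      · rw [← h₂ g hM.1 x]
        refine if_neg ?_
        rintro ⟨g', hg', x', hx', heq⟩
        exact hgM (hN g hM.1 g' (hM.2 hg') x x.2 x' hx' heq ▸ hg')
      · refine if_congr ⟨?_, ?_⟩ rfl rfl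
        · rintro ⟨g', hg', x, hx, heq⟩
          rcases Finset.mem_insert.1 hg' with rfl | hg'
          · exact absurd heq (hy x hx)
          · exact ⟨g', hg', x, hx, heq⟩
        · rintro ⟨g', hg', hx⟩
          exact ⟨g', Finset.mem_insert_of_mem hg', hx⟩
  funext y
  -- the centers of the copies that meet the neighbourhood of `y`
  let M : Finset G := (Finset.image (fun s : G × G => y * s.1 * s.2⁻¹)
    (A.neighborhood ×ˢ E)).filter (· ∈ N)
  have hM : (M : Set G) ⊆ N := fun g hg => (Finset.mem_filter.1 hg).2
  rw [← hd M hM]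
  refine A.globalMap_congr fun z hz => ?_
  by_cases hz' : ∃ g ∈ M, ∃ x ∈ E, y * z = g * x
  · exact (if_pos hz').symm
  · rw [show d M (y * z) = c₂ (y * z) from if_neg hz']
    refine hc _ fun g hg x hx heq => hz' ⟨g, Finset.mem_filter.2 ⟨Finset.mem_image.2
      ⟨(z, x), by simp [hz, hx], ?_⟩, hg⟩, x, hx, heq⟩
    simp [heq]

end CellularAutomaton

/-! ### Counting patterns that avoid an orphan -/

/-- If `u : X → Q` has to differ from prescribed patterns on disjoint sets `B i`, `i ∈ M`, of at
most `e` points each, then each of these conditions cuts the number of possibilities by the factor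
`1 - |Q| ^ (-e)` at least. Overwriting `u` with the forbidden pattern on a further set `B g` is a
map to the functions excluded by the new condition, and its fibers have at most `|Q| ^ e`
elements. -/
theorem card_avoiding_le {ι X Q : Type*} [Fintype X] [Fintype Q] [Nonempty Q]
    (p : ι → X → Q) (B : ι → Finset X) (e : ℕ) (M : Finset ι)
    (hB : ∀ i ∈ M, (B i).card ≤ e)
    (hdisj : ∀ i ∈ M, ∀ j ∈ M, i ≠ j → Disjoint (B i) (B j)) :
    (Nat.card {u : X → Q // ∀ i ∈ M, ∃ x ∈ B i, u x ≠ p i x} : ℝ) ≤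
      (1 - 1 / (Fintype.card Q : ℝ) ^ e) ^ M.card * (Fintype.card Q : ℝ) ^ Fintype.card X := by
  classical
  have hq : 1 ≤ Fintype.card Q := Fintype.card_pos
  have hq' : (1 : ℝ) ≤ (Fintype.card Q : ℝ) ^ e := one_le_pow₀ (by exact_mod_cast hq)
  rw [Nat.card_eq_fintype_card, Fintype.card_subtype]
  induction M using Finset.induction_on with
  | empty => simp
  | insert g M hgM ih =>
    specialize ih (fun i hi => hB i (Finset.mem_insert_of_mem hi))
      (fun i hi j hj => hdisj i (Finset.mem_insert_of_mem hi) j (Finset.mem_insert_of_mem hj))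
    set a : Finset (X → Q) := {u | ∀ i ∈ M, ∃ x ∈ B i, u x ≠ p i x} with ha
    have hins : ({u | ∀ i ∈ insert g M, ∃ x ∈ B i, u x ≠ p i x} : Finset (X → Q)) =
        a.filter fun u => ∃ x ∈ B g, u x ≠ p g x := by
      ext u
      simp [ha, and_comm]
    set b := a.filter fun u => ¬ ∃ x ∈ B g, u x ≠ p g x with hb
    have hsplit : (a.filter fun u => ∃ x ∈ B g, u x ≠ p g x).card + b.card = a.card :=
      Finset.card_filter_add_card_filter_not _
    let ov : (X → Q) → X → Q := fun u x => if x ∈ B g then p g x else u x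
    have hov : ∀ u ∈ a, ov u ∈ b := by
      intro u hu
      refine Finset.mem_filter.2 ⟨Finset.mem_filter.2 ⟨Finset.mem_univ _, fun i hi => ?_⟩, ?_⟩
      · obtain ⟨x, hx, hne⟩ := (Finset.mem_filter.1 hu).2 i hi
        refine ⟨x, hx, ?_⟩
        have hxg : x ∉ B g := fun hxg => Finset.disjoint_left.1
          (hdisj i (Finset.mem_insert_of_mem hi) g (Finset.mem_insert_self g M)
            (fun h => hgM (h ▸ hi))) hx hxg
        simpa [ov, hxg] using hne
      · push Not
        intro x hx
        simp [ov, hx]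
    have hfib : ∀ v ∈ b, (a.filter fun u => ov u = v).card ≤ Fintype.card Q ^ e := by
      intro v _
      have hinj : Set.InjOn (fun (u : X → Q) (x : B g) => u x)
          (a.filter fun u => ov u = v : Finset (X → Q)) := by
        intro u hu w hw huw
        have h1 := (Finset.mem_filter.1 hu).2.trans (Finset.mem_filter.1 hw).2.symm
        funext x
        by_cases hx : x ∈ B g
        · exact congrFun huw ⟨x, hx⟩
        · simpa [ov, hx] using congrFun h1 x
      refine (Finset.card_le_card_of_injOn _ (fun _ _ => Finset.mem_univ _) hinj).trans ?_
      rw [Finset.card_univ, Fintype.card_fun, Fintype.card_coe]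
      exact Nat.pow_le_pow_right hq (hB g (Finset.mem_insert_self g M))
    have hle : (a.card : ℝ) ≤ (Fintype.card Q : ℝ) ^ e * b.card := by
      exact_mod_cast Finset.card_le_mul_card_image_of_maps_to hov _ hfib
    have hle' : (a.card : ℝ) / (Fintype.card Q : ℝ) ^ e ≤ b.card :=
      (div_le_iff₀' (by linarith)).2 hle
    have hsplit' : ((a.filter fun u => ∃ x ∈ B g, u x ≠ p g x).card : ℝ) + b.card = a.card := by
      exact_mod_cast hsplit
    rw [hins, Finset.card_insert_of_notMem hgM, pow_succ', mul_assoc]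
    have hθ : (0 : ℝ) ≤ 1 - 1 / (Fintype.card Q : ℝ) ^ e :=
      sub_nonneg.2 (div_le_one_of_le₀ hq' (by linarith))
    calc ((a.filter fun u => ∃ x ∈ B g, u x ≠ p g x).card : ℝ)
        ≤ (1 - 1 / (Fintype.card Q : ℝ) ^ e) * a.card := by
          rw [sub_mul, one_mul, one_div_mul_eq_div]
          linarith
      _ ≤ _ := mul_le_mul_of_nonneg_left ih hθ

/-! ### The Myhill property -/

/-- If `F` misses a pattern on `E`, let `T` be a disk and `U` a slightly larger disk that contains
the translates of `E` near `T` and the points whose neighbourhood meets `T`. Preinjectivity gives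
`|Q| ^ |T|` distinct patterns of the image on `U`. But the orphan is avoided at a number of
disjoint places proportional to `|T|`, which costs a factor exponentially small in `|T|`, and this
outweighs the factor `|Q| ^ (|U| - |T|)` when `|U| - |T|` is a small enough proportion of `|T|`. -/
theorem CellularAutomaton.Preinjective.surjective {G Q : Type*} [Group G] [Finite Q] [Nontrivial Q]
    (hG : SubexponentialGrowth G) {A : CellularAutomaton G Q} (hA : A.Preinjective) :
    Function.Surjective A.globalMap := by
  classical
  have := Fintype.ofFinite Q
  by_contra hns
  obtain ⟨S, hSfin, hS, hgr⟩ := hG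
  obtain ⟨E, p, hE⟩ := A.exists_orphan hns
  obtain ⟨q₀⟩ : Nonempty Q := inferInstance
  have hEne : E.Nonempty := let ⟨x, hx, _⟩ := hE (fun _ => q₀) 1; ⟨x, hx⟩
  obtain ⟨N, hN, hNmax⟩ := exists_isPacking hEne
  have hEpos : (0 : ℝ) < E.card := by exact_mod_cast hEne.card_pos
  set q : ℝ := (Fintype.card Q : ℝ) with hq
  have hq1 : 1 < q := by rw [hq]; exact_mod_cast Fintype.one_lt_card
  have hqe : 1 ≤ q ^ E.card := one_le_pow₀ hq1.le
  set θ : ℝ := 1 - 1 / q ^ E.card with hθ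
  have hθ0 : 0 ≤ θ := sub_nonneg.2 (div_le_one_of_le₀ hqe (by linarith))
  have hθ1 : θ < 1 := sub_lt_self _ (by positivity)
  obtain ⟨m, hm⟩ := exists_pow_lt_of_lt_one (show 0 < 1 / q by positivity) hθ1
  have hmq : θ ^ m * q < 1 := (lt_div_iff₀ (by linarith)).1 hm
  let K : Finset G := Finset.image (fun t : G × G × G => t.1 * t.2.1⁻¹ * t.2.2) (E ×ˢ E ×ˢ E) ∪
    Finset.image (fun z => z⁻¹) A.neighborhood
  obtain ⟨k, hk⟩ := hS.exists_subset_disk K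
  obtain ⟨n, hn⟩ := exists_growth_add_lt hSfin hgr k
    (show 0 < 1 / (((m : ℝ) + 1) * (E.card : ℝ) ^ 2) by positivity)
  set T : Finset G := (disk_finite hSfin n).toFinset with hT
  set U : Finset G := (disk_finite hSfin (n + k)).toFinset with hU
  have hTcard : growth S n = T.card := Set.ncard_eq_toFinset_card _ _
  have hUcard : growth S (n + k) = U.card := Set.ncard_eq_toFinset_card _ _
  have hTU : ∀ h ∈ T, ∀ x ∈ K, h * x ∈ U := fun h hh x hx =>
    (Set.Finite.mem_toFinset _).2 (mul_mem_disk ((Set.Finite.mem_toFinset _).1 hh) (hk hx))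
  -- the centers of the translates of `E` in the packing that are close to `T`
  let M : Finset G := (Finset.image (fun t : G × G × G => t.1 * t.2.1 * t.2.2⁻¹)
    (T ×ˢ E ×ˢ E)).filter (· ∈ N)
  have hMN : ∀ g ∈ M, g ∈ N := fun g hg => (Finset.mem_filter.1 hg).2
  have hMU : ∀ g ∈ M, ∀ z ∈ E, g * z ∈ U := by
    intro g hg z hz
    obtain ⟨⟨h, x, y⟩, ht, rfl⟩ := Finset.mem_image.1 (Finset.mem_filter.1 hg).1
    simp only [Finset.mem_product] at ht
    have := hTU h ht.1 (x * y⁻¹ * z) (Finset.mem_union_left _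
      (Finset.mem_image.2 ⟨(x, y, z), by simp [ht, hz], rfl⟩))
    simpa [mul_assoc] using this
  have hTM : T.card ≤ M.card * E.card ^ 2 := by
    have hsub : T ⊆ Finset.image (fun t : G × G × G => t.1 * t.2.1 * t.2.2⁻¹) (M ×ˢ E ×ˢ E) := by
      intro h hh
      obtain ⟨g, hg, x, hx, y, hy, hxy⟩ := hNmax h
      have hgM : g ∈ M := Finset.mem_filter.2
        ⟨Finset.mem_image.2 ⟨(h, x, y), by simp [hh, hx, hy], by simp [hxy]⟩, hg⟩
      exact Finset.mem_image.2 ⟨(g, y, x), by simp [hgM, hx, hy], by simp [← hxy]⟩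
    refine (Finset.card_le_card hsub).trans (Finset.card_image_le.trans ?_)
    rw [Finset.card_product, Finset.card_product, sq]
  have hTpos : 0 < T.card := hTcard ▸ growth_pos hSfin n
  have hMpos : 0 < M.card := Nat.pos_of_ne_zero fun h => by simp [h] at hTM; simp [hTM] at hTpos
  obtain ⟨d, hd⟩ : ∃ d, U.card = T.card + d := Nat.exists_eq_add_of_le
    (Finset.card_le_card (Set.Finite.toFinset_subset_toFinset.2 (disk_mono (Nat.le_add_right n k))))
  -- the choice of the Følner constant
  have hmd : m * d ≤ M.card := by
    rw [hUcard, hTcard, hd] at hn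
    push_cast at hn
    have hTM' : (T.card : ℝ) ≤ M.card * (E.card : ℝ) ^ 2 := by exact_mod_cast hTM
    have h1 : (d : ℝ) ≤ T.card / (((m : ℝ) + 1) * (E.card : ℝ) ^ 2) := by
      rw [add_mul, one_mul, one_div_mul_eq_div] at hn
      linarith
    rw [le_div_iff₀ (by positivity)] at h1
    have h2 : ((d : ℝ) * (m + 1)) * (E.card : ℝ) ^ 2 ≤ M.card * (E.card : ℝ) ^ 2 := by
      linarith
    have h3 := le_of_mul_le_mul_right h2 (by positivity)
    have h4 : d * (m + 1) ≤ M.card := by exact_mod_cast h3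
    calc m * d ≤ d * (m + 1) := by rw [mul_comm]; exact Nat.mul_le_mul_left d (Nat.le_succ m)
      _ ≤ M.card := h4
  let B : G → Finset U := fun g => {u | g⁻¹ * (u : G) ∈ E}
  have hupper := card_avoiding_le (fun g (u : U) => p (g⁻¹ * u)) B E.card M
    (fun g _ => Finset.card_le_card_of_injOn (fun u : U => g⁻¹ * (u : G))
      (fun u hu => (Finset.mem_filter.1 hu).2)
      fun u _ w _ huw => Subtype.ext (mul_left_cancel huw))
    (fun g hg h hh hne => Finset.disjoint_left.2 fun u hu hu' => hne
      (hN g (hMN g hg) h (hMN h hh) _ (Finset.mem_filter.1 hu).2 _ (Finset.mem_filter.1 hu').2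
        (by simp)))
  let ext : (T → Q) → G → Q := fun t y => if h : y ∈ T then t ⟨y, h⟩ else q₀
  have hext : ∀ t y, y ∉ T → ext t y = q₀ := fun t y hy => dif_neg hy
  have hlower : Nat.card (T → Q) ≤ Nat.card
      {u : U → Q // ∀ g ∈ M, ∃ x ∈ B g, u x ≠ p (g⁻¹ * (x : G))} := by
    refine Nat.card_le_card_of_injective (fun t => ⟨fun u => A.globalMap (ext t) u, ?_⟩) ?_
    · intro g hg
      obtain ⟨x, hx, hne⟩ := hE (ext t) g
      exact ⟨⟨g * x, hMU g hg x hx⟩, by simpa [B] using hx, by simpa using hne⟩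
    · intro s t hst
      have heq : ext s = ext t := by
        refine hA.eq_of_globalMap_eq (T := T) (fun y hy => by rw [hext s y hy, hext t y hy]) ?_
        funext y
        by_cases hy : y ∈ U
        · exact congrFun (congrArg Subtype.val hst) ⟨y, hy⟩
        · refine A.globalMap_congr fun z hz => ?_
          have hyz : y * z ∉ T := fun hyz => hy (by
            simpa using hTU _ hyz z⁻¹ (Finset.mem_union_right _ (Finset.mem_image_of_mem _ hz)))
          rw [hext s _ hyz, hext t _ hyz]
      funext x
      simpa [ext] using congrFun heq x
  have hcount : q ^ T.card ≤ θ ^ M.card * q ^ (T.card + d) := by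
    have h : ((Nat.card (T → Q) : ℕ) : ℝ) = q ^ T.card := by simp [hq]
    rw [← h, ← hd, ← Fintype.card_coe U]
    exact le_trans (by exact_mod_cast hlower) hupper
  have hone : 1 ≤ θ ^ M.card * q ^ d := by
    have hqT : 0 < q ^ T.card := by positivity
    rw [pow_add] at hcount
    refine le_of_mul_le_mul_right ?_ hqT
    linarith
  rcases Nat.eq_zero_or_pos d with rfl | hdpos
  · rw [pow_zero, mul_one] at hone
    exact absurd hone (not_le.2 (pow_lt_one₀ hθ0 hθ1 hMpos.ne'))
  · have h1 : θ ^ M.card * q ^ d ≤ (θ ^ m * q) ^ d := by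
      rw [mul_pow, ← pow_mul]
      exact mul_le_mul_of_nonneg_right (pow_le_pow_of_le_one hθ0 hθ1.le hmd) (by positivity)
    exact absurd (hone.trans h1) (not_le.2 (pow_lt_one₀ (by positivity) hmq hdpos.ne'))

/-! ### Besicovitch surjectivity and injectivity -/

/-- A configuration with copies of an orphan along a maximal packing is at positive distance from
every configuration of the image. -/
theorem BSurjective.surjective {G Q : Type*} [Group G] [Finite Q] [Nonempty Q] {S : Set G}
    (hSfin : S.Finite) (hS : Generates S) {A : CellularAutomaton G Q}
    (h : BSurjective (disk S) A.globalMap) : Function.Surjective A.globalMap := by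
  by_contra hns
  obtain ⟨E, p, hE⟩ := A.exists_orphan hns
  obtain ⟨q₀⟩ := ‹Nonempty Q›
  have hEne : E.Nonempty := let ⟨x, hx, _⟩ := hE (fun _ => q₀) 1; ⟨x, hx⟩
  obtain ⟨N, hN, hNmax⟩ := exists_isPacking hEne
  obtain ⟨c, hc, -⟩ := hN.exists_config p q₀
  obtain ⟨c', hc'⟩ := h c
  refine (besicovitchDist_disk_pos_of_packing hSfin hS hNmax fun g hg => ?_).ne' hc'
  obtain ⟨x, hx, hne⟩ := hE c' g
  exact ⟨x, hx, by rw [hc g hg x hx]; exact hne.symm⟩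

/-- Copies of two distinct mutually erasable patterns along a maximal packing give two
configurations at positive distance with the same image. -/
theorem BInjective.preinjective {G Q : Type*} [Group G] [Nonempty Q] {S : Set G}
    (hSfin : S.Finite) (hS : Generates S) {A : CellularAutomaton G Q}
    (h : BInjective (disk S) A.globalMap) : A.Preinjective := by
  classical
  rintro ⟨E, p₁, p₂, hne, her⟩
  obtain ⟨e, he⟩ := Function.ne_iff.1 hne
  obtain ⟨q₀⟩ := ‹Nonempty Q›
  obtain ⟨N, hN, hNmax⟩ := exists_isPacking (E := E) ⟨e, e.2⟩
  obtain ⟨c₁, h₁, hb₁⟩ := hN.exists_config (fun y => if hy : y ∈ E then p₁ ⟨y, hy⟩ else q₀) q₀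
  obtain ⟨c₂, h₂, hb₂⟩ := hN.exists_config (fun y => if hy : y ∈ E then p₂ ⟨y, hy⟩ else q₀) q₀
  have h₁' : ∀ g ∈ N, ∀ x : E, c₁ (g * x) = p₁ x := fun g hg x => by simp [h₁ g hg x x.2]
  have h₂' : ∀ g ∈ N, ∀ x : E, c₂ (g * x) = p₂ x := fun g hg x => by simp [h₂ g hg x x.2]
  have hF : A.globalMap c₁ = A.globalMap c₂ :=
    her.globalMap_eq_of_packing hN h₁' h₂' fun y hy => (hb₁ y hy).trans (hb₂ y hy).symm
  have hpos := h c₁ c₂ <| besicovitchDist_disk_pos_of_packing hSfin hS hNmax fun g hg =>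
    ⟨e, e.2, by rwa [h₁' g hg e, h₂' g hg e]⟩
  rw [hF, besicovitchDist_self] at hpos
  exact lt_irrefl _ hpos

end Besicovitch

theorem mainTheorem3 {G Q : Type*} [Group G] [Finite Q] [Nontrivial Q]
    (hG : Besicovitch.SubexponentialGrowth G)
    (S : Set G) (hSfin : S.Finite) (hS : Besicovitch.Generates S)
    (A : Besicovitch.CellularAutomaton G Q) :
    (Besicovitch.BSurjective (Besicovitch.disk S) A.globalMap →
      Function.Surjective A.globalMap) ∧
    (Besicovitch.BInjective (Besicovitch.disk S) A.globalMap → A.Preinjective) ∧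
    (Besicovitch.BInjective (Besicovitch.disk S) A.globalMap →
      Besicovitch.BSurjective (Besicovitch.disk S) A.globalMap) := by
  refine ⟨fun h => h.surjective hSfin hS, fun h => h.preinjective hSfin hS, fun h c => ?_⟩
  obtain ⟨c', rfl⟩ := (h.preinjective hSfin hS).surjective hG c
  exact ⟨c', Besicovitch.besicovitchDist_self _ _⟩
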